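/- Let $(X,d)$ be a locally compact metric space that is rectifiably connected (any two points are joined by a curve of finite length) and incomplete, i.e. its metric boundary $\partial X=\overline{X}\setminus X$, where $\overline X$ is the metric completion, is nonempty. Write $d(z)=\operatorname{dist}(z,\partial X)$ for $z\in X$, let $\ell$ denote length with respect to $d$, and let $$k(x,y)=\inf_\gamma\int_\gamma\frac{|dz|}{d(z)}$$ be the quasihyperbolic metric of $X$, the infimum being over all rectifiable curves $\gamma$ in $X$ from $x$ to $y$, with $|dz|$ the arc-length element with respect to $d$. For $c\ge 1$, an arc $\gamma$ in $X$ joining $x$ to $x_0$ is a $c$-cone arc if $\ell(\gamma[x,z])\le c\,d(z)$ for all $z\in\gamma$, where $\gamma[x,z]$ is the subarc of $\gamma$ between $x$ and $z$. The space $X$ is $a$-John with center $x_0$ if every $x\in X$ can be joined to $x_0$ by an $a$-cone arc. A quasihyperbolic geodesic is a geodesic of $(X,k)$, that is, a map $\alpha:[0,l]\to X$ with $k(\alpha(s),\alpha(t))=|s-t|$ for all $s,t\in[0,l]$. The space $(X,k)$ is Gromov $\delta$-hyperbolic if any two points are joined by a quasihyperbolic geodesic and, for all quasihyperbolic geodesics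 $[x,y],[y,z],[z,x]$, every point of $[x,y]$ is within $k$-distance $\delta$ of $[y,z]\cup[z,x]$. **Theorem.** For all $a\ge 1$ and $\delta\ge 0$ there is a constant $M=M(a,\delta)\ge 1$, depending only on $a$ and $\delta$, with the following property. Let $X$ be as above and $x_0\in X$. If $X$ is $a$-John with center $x_0$ and $(X,k)$ is Gromov $\delta$-hyperbolic, then every quasihyperbolic geodesic starting from $x_0$, with other endpoint $x\in X$, is an $M$-cone arc joining $x$ to $x_0$. That is, $X$ is quasihyperbolic $M$-John with center $x_0$: for each $x\in X$, every quasihyperbolic geodesic joining $x$ to $x_0$ is an $M$-cone arc. -/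

import Mathlib

open Set MeasureTheory
open scoped ENNReal

noncomputable section

section MetricBoundary

variable {X : Type*} [MetricSpace X]

/-- The metric boundary `∂X = X̄ \ X`, where `X̄` is the metric completion of `X`. -/
def metricBoundary (X : Type*) [MetricSpace X] : Set (UniformSpace.Completion X) :=
  (range ((↑) : X → UniformSpace.Completion X))ᶜ

/-- `d(x) = dist(x, ∂X)`, the distance being taken in the completion. It is only used for spaces
with nonempty metric boundary. -/
def boundaryDist (x : X) : ℝ :=
  Metric.infDist (x : UniformSpace.Completion X) (metricBoundary X)

/-- `γ`, restricted to the compact interval `[u, v]`, is a curve in `X` from `x` to `y`. The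
interval may be a single point; values of `γ` outside `[u, v]` are irrelevant. -/
structure IsCurve (γ : ℝ → X) (u v : ℝ) (x y : X) : Prop where
  le : u ≤ v
  left : γ u = x
  right : γ v = y
  continuousOn : ContinuousOn γ (Icc u v)

/-- The length of `γ` restricted to `[u, v]`. -/
def curveLength (γ : ℝ → X) (u v : ℝ) : ℝ≥0∞ := eVariationOn γ (Icc u v)

/-- A rectifiable curve from `x` to `y`: a curve of finite length. -/
def IsRectifiableCurve (γ : ℝ → X) (u v : ℝ) (x y : X) : Prop :=
  IsCurve γ u v x y ∧ curveLength γ u v ≠ ∞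

/-- Every pair of points can be joined by a curve of finite length. -/
def RectifiablyConnected (X : Type*) [MetricSpace X] : Prop :=
  ∀ x y : X, ∃ (γ : ℝ → X) (u v : ℝ), IsRectifiableCurve γ u v x y

/-- The line integral `∫_γ f |dz|` of a nonnegative function `f` along the rectifiable curve
`γ : [u, v] → X` with respect to arc length: `∫₀^ℓ(γ) f(γₛ(t)) dt`, where `γₛ : [0, ℓ(γ)] → X` is
the arc-length parametrization of `γ`. -/
def arcLengthIntegral (f : X → ℝ≥0∞) (γ : ℝ → X) (u v : ℝ) : ℝ≥0∞ :=
  ∫⁻ t in Icc 0 (curveLength γ u v).toReal, f (naturalParameterization γ (Icc u v) u t)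

/-- The quasihyperbolic metric `k(x, y) = inf ∫_γ |dz| / d(z)`, the infimum being over all
rectifiable curves `γ` in `X` from `x` to `y`. -/
def quasihyperbolicDist (x y : X) : ℝ≥0∞ :=
  ⨅ (γ : ℝ → X) (u : ℝ) (v : ℝ) (_ : IsRectifiableCurve γ u v x y),
    arcLengthIntegral (fun z => (ENNReal.ofReal (boundaryDist z))⁻¹) γ u v

/-- `γ : [u, v] → X` is an `a`-cone arc joining `x` to `x₀`: it is an arc (an embedding of the
interval) from `x` to `x₀`, and `ℓ(γ[x, z]) ≤ a d(z)` for every `z ∈ γ`. -/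
structure IsConeArc (a : ℝ) (γ : ℝ → X) (u v : ℝ) (x x₀ : X) : Prop where
  isCurve : IsCurve γ u v x x₀
  injOn : InjOn γ (Icc u v)
  length_le : ∀ t ∈ Icc u v, curveLength γ u t ≤ ENNReal.ofReal (a * boundaryDist (γ t))

/-- The space `X` is `a`-John with center `x₀`. -/
def IsJohnWithCenter (a : ℝ) (x₀ : X) : Prop :=
  ∀ x : X, ∃ (γ : ℝ → X) (u v : ℝ), IsConeArc a γ u v x x₀

end MetricBoundary

section Hyperbolic

variable {X : Type*}

/-- `α : [0, l] → X` is a geodesic from `x` to `y` for the distance function `ρ`. -/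
structure IsGeodesicArc (ρ : X → X → ℝ≥0∞) (α : ℝ → X) (l : ℝ) (x y : X) : Prop where
  nonneg : 0 ≤ l
  left : α 0 = x
  right : α l = y
  dist_eq : ∀ s ∈ Icc 0 l, ∀ t ∈ Icc 0 l, ρ (α s) (α t) = ENNReal.ofReal |s - t|

/-- `(X, ρ)` is Gromov `δ`-hyperbolic: it is a geodesic space, and for every geodesic triangle with
sides `[x, y]`, `[y, z]`, `[z, x]`, every point of `[x, y]` is within distance `δ` of
`[y, z] ∪ [z, x]`. -/
structure IsGromovHyperbolic (δ : ℝ) (ρ : X → X → ℝ≥0∞) : Prop where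
  geodesic : ∀ x y : X, ∃ (α : ℝ → X) (l : ℝ), IsGeodesicArc ρ α l x y
  slim : ∀ (x y z : X) (α β γ : ℝ → X) (l m n : ℝ),
    IsGeodesicArc ρ α l x y → IsGeodesicArc ρ β m y z → IsGeodesicArc ρ γ n z x →
    ∀ p ∈ α '' Icc 0 l, ∃ q ∈ β '' Icc 0 m ∪ γ '' Icc 0 n, ρ p q ≤ ENNReal.ofReal δ

end Hyperbolic

section QuasihyperbolicJohn

variable {X : Type*} [MetricSpace X]

/-- `α : [0, l] → X` is a quasihyperbolic geodesic from `x` to `y`. -/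
def IsQuasihyperbolicGeodesic (α : ℝ → X) (l : ℝ) (x y : X) : Prop :=
  IsGeodesicArc quasihyperbolicDist α l x y

/-- The space `X` is quasihyperbolic `a`-John with center `x₀`: for each `x`, every quasihyperbolic
geodesic joining `x` to `x₀` is an `a`-cone arc. -/
def IsQuasihyperbolicJohn (a : ℝ) (x₀ : X) : Prop :=
  ∀ (x : X) (α : ℝ → X) (l : ℝ), IsQuasihyperbolicGeodesic α l x x₀ → IsConeArc a α 0 l x x₀

end QuasihyperbolicJohn

end

/-! A cone arc from `x` to the John center is a quasigeodesic for the quasihyperbolic metric `k`: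
at arc length `t` from `x` the boundary distance `d` is at least `t / a` and at most `d(x) + t`. So
if the arc is sampled at the arc lengths `2 ^ j * d(x) / 4`, consecutive samples are at bounded
`k`-distance, while `d` doubles from sample to sample up to a constant factor, and
`k(y, z) ≥ log (d(z) / d(y))` (`IsConeArc.exists_chain`, with `ofReal_log_le_quasihyperbolicDist`
and `IsRectifiableCurve.quasihyperbolicDist_le` for the two estimates of `k`).

In a Gromov hyperbolic space a geodesic stays close to a quasigeodesic chain with the same ends
(`exists_quasigeodesic_chain_bound`), and follows it monotonically
(`exists_monotone_quasigeodesic_chain_bound`). Hence `d` grows exponentially, up to constants, with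
the `k`-length along a quasihyperbolic geodesic `α` from `x` to the center:
`d(α s) ≤ A * exp (-ε (t - s)) * d(α t)` for `s ≤ t` (`exists_boundaryDist_le_exp_neg_mul`). Since
the length element of `α` is at most `d(α s) ds`, the length of the part of `α` before `α t` is at
most a geometric integral, bounded by a multiple of `d(α t)`
(`IsQuasihyperbolicGeodesic.isConeArc`).

Most of what makes `k` a pseudometric is read off the geodesics, whose existence is part of
hyperbolicity; only the triangle inequality needs the concatenation of curves. -/

open Set MeasureTheory
open scoped ENNReal

/-! ### The distance to the metric boundary -/

section BoundaryDistance

variable {X : Type*} [MetricSpace X]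

open UniformSpace Filter Topology

/-- A locally compact metric space is open in its completion: a compact neighbourhood of `x` is
closed in the completion, hence contains the closure of the points of `X` near `x`. -/
theorem isOpen_range_coe_completion [LocallyCompactSpace X] :
    IsOpen (range ((↑) : X → Completion X)) := by
  rw [isOpen_iff_mem_nhds]
  rintro _ ⟨x, rfl⟩
  obtain ⟨K, hK, hKx⟩ := exists_compact_mem_nhds x
  obtain ⟨ε, hε, hball⟩ := Metric.mem_nhds_iff.1 hKx
  have hclosed : IsClosed (((↑) : X → Completion X) '' K) :=
    (hK.image (Completion.continuous_coe X)).isClosed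
  refine mem_of_superset (Metric.ball_mem_nhds (x : Completion X) hε) fun y hy => ?_
  refine image_subset_range _ K (hclosed.closure_subset_iff.2 ?_
    (Completion.denseRange_coe.open_subset_closure_inter Metric.isOpen_ball hy))
  rintro _ ⟨hz, z, rfl⟩
  rw [Metric.mem_ball, Completion.dist_eq] at hz
  exact ⟨z, hball hz, rfl⟩

theorem boundaryDist_pos [LocallyCompactSpace X] (hne : (metricBoundary X).Nonempty) (x : X) :
    0 < boundaryDist x := by
  have hcl : IsClosed (metricBoundary X) := isOpen_range_coe_completion.isClosed_compl
  exact (hcl.notMem_iff_infDist_pos hne).1 fun h => h ⟨x, rfl⟩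

theorem boundaryDist_le_add_dist (x y : X) : boundaryDist x ≤ boundaryDist y + dist x y := by
  rw [← Completion.dist_eq]
  exact Metric.infDist_le_infDist_add_dist

end BoundaryDistance

/-! ### Arc length of rectifiable curves -/

section Length

variable {X : Type*} [MetricSpace X] {γ : ℝ → X} {u v : ℝ} {x y : X}

theorem curveLength_add (γ : ℝ → X) {a b c : ℝ} (hab : a ≤ b) (hbc : b ≤ c) :
    curveLength γ a b + curveLength γ b c = curveLength γ a c := by
  have h := eVariationOn.Icc_add_Icc γ (s := univ) hab hbc (mem_univ b)
  simp only [univ_inter] at h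
  exact h

theorem curveLength_self (γ : ℝ → X) (a : ℝ) : curveLength γ a a = 0 :=
  eVariationOn.subsingleton _ (by simp)

theorem curveLength_mono (γ : ℝ → X) {a b p q : ℝ} (h : Icc p q ⊆ Icc a b) :
    curveLength γ p q ≤ curveLength γ a b :=
  eVariationOn.mono _ h

theorem edist_le_curveLength (γ : ℝ → X) {a b : ℝ} (h : a ≤ b) :
    edist (γ a) (γ b) ≤ curveLength γ a b :=
  eVariationOn.edist_le _ (left_mem_Icc.2 h) (right_mem_Icc.2 h)

namespace IsRectifiableCurve

theorem curveLength_ne_top (h : IsRectifiableCurve γ u v x y) {p q : ℝ} (hp : u ≤ p)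
    (hq : q ≤ v) : curveLength γ p q ≠ ∞ :=
  ne_top_of_le_ne_top h.2 (curveLength_mono γ (Icc_subset_Icc hp hq))

theorem subcurve (h : IsRectifiableCurve γ u v x y) {p q : ℝ} (hp : u ≤ p) (hpq : p ≤ q)
    (hq : q ≤ v) : IsRectifiableCurve γ p q (γ p) (γ q) :=
  ⟨⟨hpq, rfl, rfl, h.1.continuousOn.mono (Icc_subset_Icc hp hq)⟩, h.curveLength_ne_top hp hq⟩

theorem locallyBoundedVariationOn (h : IsRectifiableCurve γ u v x y) :
    LocallyBoundedVariationOn γ (Icc u v) :=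
  BoundedVariationOn.locallyBoundedVariationOn h.2

theorem variationOnFromTo_eq {r : ℝ} (hr : r ∈ Icc u v) :
    variationOnFromTo γ (Icc u v) u r = (curveLength γ u r).toReal := by
  rw [variationOnFromTo.eq_of_le _ _ hr.1, inter_eq_right.2 (Icc_subset_Icc_right hr.2)]
  rfl

/-- The arc-length function of a rectifiable curve is continuous. -/
theorem continuousOn_toReal_curveLength (h : IsRectifiableCurve γ u v x y) :
    ContinuousOn (fun r => (curveLength γ u r).toReal) (Icc u v) := by
  refine ContinuousOn.congr (f := variationOnFromTo γ (Icc u v) u) ?_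
    fun r hr => (variationOnFromTo_eq hr).symm
  intro r hr
  have hu : u ∈ Icc u v := left_mem_Icc.2 h.1.le
  have hc : ContinuousWithinAt γ (Icc u v) r := h.1.continuousOn r hr
  have hl := variationOnFromTo.tendsto_left hu hr h.locallyBoundedVariationOn
    (hc.mono_left (nhdsWithin_mono _ inter_subset_left))
  have hg := variationOnFromTo.tendsto_right hu hr h.locallyBoundedVariationOn
    (hc.mono_left (nhdsWithin_mono _ inter_subset_left))
  rw [dist_self, sub_zero] at hl
  rw [dist_self, add_zero] at hg
  rw [← continuousWithinAt_sdiff_self]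
  refine (hl.sup hg).mono_left ?_
  rw [← nhdsWithin_union, ← inter_union_distrib_left, Iio_union_Ioi]
  rfl

theorem exists_curveLength_eq (h : IsRectifiableCurve γ u v x y) {t : ℝ}
    (ht : t ∈ Icc 0 (curveLength γ u v).toReal) :
    ∃ r ∈ Icc u v, (curveLength γ u r).toReal = t := by
  refine intermediate_value_Icc h.1.le h.continuousOn_toReal_curveLength ?_
  rwa [curveLength_self, ENNReal.toReal_zero]

theorem naturalParameterization_apply (h : IsRectifiableCurve γ u v x y) {r : ℝ}
    (hr : r ∈ Icc u v) :
    naturalParameterization γ (Icc u v) u (curveLength γ u r).toReal = γ r := by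
  rw [← edist_eq_zero, ← variationOnFromTo_eq hr]
  exact edist_naturalParameterization_eq_zero h.locallyBoundedVariationOn
    (left_mem_Icc.2 h.1.le) hr

theorem eq_of_curveLength_eq (h : IsRectifiableCurve γ u v x y) {r s : ℝ}
    (hr : r ∈ Icc u v) (hs : s ∈ Icc u v)
    (hrs : (curveLength γ u r).toReal = (curveLength γ u s).toReal) : γ r = γ s := by
  rw [← h.naturalParameterization_apply hr, hrs, h.naturalParameterization_apply hs]

end IsRectifiableCurve

end Length

/-! ### The quasihyperbolic distance -/

section Concatenation

variable {X : Type*} {γ γ' : ℝ → X} {v u' : ℝ}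

/-- The curve `γ` on `[u, v]` followed by `γ'`, whose parameter is shifted from `[u', v']`. -/
noncomputable def concatCurve (γ : ℝ → X) (v : ℝ) (γ' : ℝ → X) (u' : ℝ) : ℝ → X :=
  fun r => if r ≤ v then γ r else γ' (r - v + u')

theorem concatCurve_of_le {r : ℝ} (h : r ≤ v) : concatCurve γ v γ' u' r = γ r := if_pos h

theorem concatCurve_of_ge {r : ℝ} (heq : γ v = γ' u') (h : v ≤ r) :
    concatCurve γ v γ' u' r = γ' (r - v + u') := by
  rcases h.eq_or_lt with rfl | h
  · rw [concatCurve_of_le le_rfl, sub_self, zero_add, heq]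
  · exact if_neg h.not_ge

end Concatenation

section QuasihyperbolicDistance

variable {X : Type*} [MetricSpace X] {γ γ' : ℝ → X} {u v u' v' : ℝ} {x y z : X}

theorem curveLength_concatCurve_of_le {p r : ℝ} (h : r ≤ v) :
    curveLength (concatCurve γ v γ' u') p r = curveLength γ p r :=
  eVariationOn.congr fun _ hs => concatCurve_of_le (hs.2.trans h)

theorem curveLength_concatCurve_of_ge {r : ℝ} (heq : γ v = γ' u') :
    curveLength (concatCurve γ v γ' u') v r = curveLength γ' u' (r - v + u') := by
  have h1 : curveLength (concatCurve γ v γ' u') v r =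
      eVariationOn (γ' ∘ fun s => s - v + u') (Icc v r) :=
    eVariationOn.congr fun s hs => concatCurve_of_ge heq hs.1
  have hmono : MonotoneOn (fun s : ℝ => s - v + u') (Icc v r) := fun a _ b _ hab => by
    dsimp only; linarith
  rw [h1, eVariationOn.comp_eq_of_monotoneOn γ' _ hmono, curveLength]
  congr 1
  have : (fun s : ℝ => s - v + u') = fun s => s + (u' - v) := by ext s; ring
  rw [this, image_add_const_Icc]
  congr 1 <;> ring

theorem IsRectifiableCurve.concat (h : IsRectifiableCurve γ u v x y)
    (h' : IsRectifiableCurve γ' u' v' y z) :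
    IsRectifiableCurve (concatCurve γ v γ' u') u (v + (v' - u')) x z := by
  have heq : γ v = γ' u' := h.1.right.trans h'.1.left.symm
  have hv : v ≤ v + (v' - u') := by linarith [h'.1.le]
  refine ⟨⟨h.1.le.trans hv, ?_, ?_, ?_⟩, ?_⟩
  · rw [concatCurve_of_le h.1.le, h.1.left]
  · rw [concatCurve_of_ge heq hv, ← h'.1.right]
    congr 1; ring
  · rw [← Icc_union_Icc_eq_Icc h.1.le hv]
    refine ContinuousOn.union_of_isClosed ?_ ?_ isClosed_Icc isClosed_Icc
    · exact h.1.continuousOn.congr fun r hr => concatCurve_of_le hr.2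
    · refine ContinuousOn.congr (f := γ' ∘ fun s => s - v + u') ?_
        fun r hr => concatCurve_of_ge heq hr.1
      exact h'.1.continuousOn.comp (by fun_prop)
        fun r hr => ⟨by linarith [hr.1], by linarith [hr.2]⟩
  · rw [← curveLength_add _ h.1.le hv, curveLength_concatCurve_of_le le_rfl,
      curveLength_concatCurve_of_ge heq, ENNReal.add_ne_top]
    refine ⟨h.2, ?_⟩
    convert h'.2 using 2
    ring

theorem arcLengthIntegral_concatCurve_le (f : X → ℝ≥0∞) (h : IsRectifiableCurve γ u v x y)
    (h' : IsRectifiableCurve γ' u' v' y z) :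
    arcLengthIntegral f (concatCurve γ v γ' u') u (v + (v' - u')) ≤
      arcLengthIntegral f γ u v + arcLengthIntegral f γ' u' v' := by
  have heq : γ v = γ' u' := h.1.right.trans h'.1.left.symm
  have hv : v ≤ v + (v' - u') := by linarith [h'.1.le]
  have hc := h.concat h'
  set η := concatCurve γ v γ' u' with hη
  set L := (curveLength γ u v).toReal with hL
  set L' := (curveLength γ' u' v').toReal with hL'
  have hlen : ∀ r ∈ Icc u' v', (curveLength η u (r - u' + v)).toReal =
      L + (curveLength γ' u' r).toReal := by
    intro r hr
    rw [← curveLength_add _ h.1.le (by linarith [hr.1] : v ≤ r - u' + v),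
      curveLength_concatCurve_of_le le_rfl, curveLength_concatCurve_of_ge heq,
      show r - u' + v - v + u' = r by ring,
      ENNReal.toReal_add h.2 (h'.curveLength_ne_top le_rfl hr.2)]
  have hT : (curveLength η u (v + (v' - u'))).toReal = L + L' := by
    rw [← hlen v' (right_mem_Icc.2 h'.1.le), show v' - u' + v = v + (v' - u') by ring]
  have hL0 : 0 ≤ L := ENNReal.toReal_nonneg
  have hL0' : 0 ≤ L' := ENNReal.toReal_nonneg
  rw [arcLengthIntegral, hT, ← Icc_union_Icc_eq_Icc hL0 (by linarith : L ≤ L + L')]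
  refine (lintegral_union_le _ _ _).trans (add_le_add (le_of_eq ?_) (le_of_eq ?_))
  · refine setLIntegral_congr_fun measurableSet_Icc fun t ht => ?_
    obtain ⟨r, hr, hrt⟩ := h.exists_curveLength_eq ht
    have h1 := hc.naturalParameterization_apply (r := r) ⟨hr.1, hr.2.trans hv⟩
    rw [curveLength_concatCurve_of_le hr.2, hrt, hη, concatCurve_of_le hr.2] at h1
    have h2 := h.naturalParameterization_apply hr
    rw [hrt] at h2
    rw [h1, h2]
  · have hpre : (fun t : ℝ => t + L) ⁻¹' Icc L (L + L') = Icc 0 L' := by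
      rw [preimage_add_const_Icc, sub_self, add_sub_cancel_left]
    rw [← (measurePreserving_add_right (volume : Measure ℝ) L).setLIntegral_comp_preimage_emb
      (measurableEmbedding_addRight L), hpre]
    refine setLIntegral_congr_fun measurableSet_Icc fun t ht => ?_
    obtain ⟨r, hr, hrt⟩ := h'.exists_curveLength_eq ht
    have h1 := hc.naturalParameterization_apply (r := r - u' + v)
      ⟨by linarith [h.1.le, hr.1], by linarith [hr.2]⟩
    rw [hlen r hr, hrt, hη, concatCurve_of_ge heq (by linarith [hr.1]),
      show r - u' + v - v + u' = r by ring, add_comm L t] at h1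
    have h2 := h'.naturalParameterization_apply hr
    rw [hrt] at h2
    rw [h1, h2]

theorem quasihyperbolicDist_triangle (x y z : X) :
    quasihyperbolicDist x z ≤ quasihyperbolicDist x y + quasihyperbolicDist y z := by
  refine ENNReal.le_of_forall_pos_le_add fun ε hε hfin => ?_
  have hε' : (0 : ℝ≥0∞) < ε / 2 := by
    simpa using ENNReal.half_pos (by exact_mod_cast hε.ne' : (ε : ℝ≥0∞) ≠ 0)
  rw [ENNReal.add_lt_top] at hfin
  have h1 := ENNReal.lt_add_right hfin.1.ne hε'.ne'
  have h2 := ENNReal.lt_add_right hfin.2.ne hε'.ne'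
  conv_lhs at h1 => rw [quasihyperbolicDist]
  conv_lhs at h2 => rw [quasihyperbolicDist]
  simp only [iInf_lt_iff] at h1 h2
  obtain ⟨γ, u, v, h, hlt⟩ := h1
  obtain ⟨γ', u', v', h', hlt'⟩ := h2
  calc quasihyperbolicDist x z ≤ _ :=
        iInf₂_le_of_le _ _ (iInf₂_le (v + (v' - u')) (h.concat h'))
    _ ≤ _ := arcLengthIntegral_concatCurve_le _ h h'
    _ ≤ (quasihyperbolicDist x y + ε / 2) + (quasihyperbolicDist y z + ε / 2) :=
        add_le_add hlt.le hlt'.le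
    _ = quasihyperbolicDist x y + quasihyperbolicDist y z + ε := by
        rw [add_add_add_comm, ENNReal.add_halves]

/-- Along a curve of length at most `L` on which `d ≥ m`, the density `1 / d` integrates to at most
`L / m`. -/
theorem IsRectifiableCurve.quasihyperbolicDist_le (h : IsRectifiableCurve γ u v x y) {L m : ℝ}
    (hm : 0 < m) (hL : (curveLength γ u v).toReal ≤ L)
    (hd : ∀ r ∈ Icc u v, m ≤ boundaryDist (γ r)) :
    quasihyperbolicDist x y ≤ ENNReal.ofReal (L / m) := by
  refine (iInf₂_le_of_le γ u (iInf₂_le v h)).trans ?_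
  have hL0 : 0 ≤ L := ENNReal.toReal_nonneg.trans hL
  calc arcLengthIntegral (fun z => (ENNReal.ofReal (boundaryDist z))⁻¹) γ u v
      ≤ ∫⁻ _ in Icc 0 (curveLength γ u v).toReal, (ENNReal.ofReal m)⁻¹ := by
        refine setLIntegral_mono' measurableSet_Icc fun t ht => ?_
        obtain ⟨r, hr, rfl⟩ := h.exists_curveLength_eq ht
        rw [h.naturalParameterization_apply hr]
        exact ENNReal.inv_le_inv.2 (ENNReal.ofReal_le_ofReal (hd r hr))
    _ = (ENNReal.ofReal m)⁻¹ * ENNReal.ofReal (curveLength γ u v).toReal := by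
        rw [setLIntegral_const, Real.volume_Icc, sub_zero]
    _ ≤ (ENNReal.ofReal m)⁻¹ * ENNReal.ofReal L := by gcongr
    _ = ENNReal.ofReal (L / m) := by
        rw [ENNReal.ofReal_div_of_pos hm, div_eq_mul_inv, mul_comm]

theorem ofReal_log_le_lintegral_inv {b L : ℝ} (hb : 0 < b) (hL : 0 ≤ L) :
    ENNReal.ofReal (Real.log ((b + L) / b)) ≤ ∫⁻ t in Icc 0 L, (ENNReal.ofReal (b + t))⁻¹ := by
  have h1 : ∫ t in (0 : ℝ)..L, (b + t)⁻¹ = Real.log ((b + L) / b) := by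
    rw [intervalIntegral.integral_comp_add_left (fun t => t⁻¹) b, add_zero,
      integral_inv_of_pos hb (by linarith)]
  have hint : IntegrableOn (fun t : ℝ => (b + t)⁻¹) (Icc 0 L) :=
    (ContinuousOn.inv₀ (by fun_prop) fun t ht => by linarith [ht.1]).integrableOn_Icc
  rw [← h1, intervalIntegral.integral_of_le hL, ← integral_Icc_eq_integral_Ioc,
    ofReal_integral_eq_lintegral_ofReal hint]
  · refine (setLIntegral_congr_fun measurableSet_Icc fun t ht => ?_).le
    exact ENNReal.ofReal_inv_of_pos (by linarith [ht.1])
  · exact (ae_restrict_iff' measurableSet_Icc).2 (Filter.Eventually.of_forall fun t ht =>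
      inv_nonneg.2 (by linarith [ht.1]))

/-- The basic lower bound for `k`: since `d ≤ d(x) + t` after arc length `t` along a curve from `x`,
the density `1 / d` integrates to at least `log (1 + ℓ / d(x))`. -/
theorem ofReal_log_le_quasihyperbolicDist (hx : 0 < boundaryDist x) (y : X) :
    ENNReal.ofReal (Real.log ((boundaryDist x + dist x y) / boundaryDist x)) ≤
      quasihyperbolicDist x y := by
  refine le_iInf₂ fun γ u => le_iInf₂ fun v h => ?_
  set L := (curveLength γ u v).toReal with hL
  have hdist : ∀ r ∈ Icc u v, dist x (γ r) ≤ (curveLength γ u r).toReal := by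
    intro r hr
    rw [← h.1.left, dist_edist]
    exact ENNReal.toReal_mono (h.curveLength_ne_top le_rfl hr.2) (edist_le_curveLength γ hr.1)
  have hxy : dist x y ≤ L := by
    have := hdist v (right_mem_Icc.2 h.1.le)
    rwa [h.1.right] at this
  calc ENNReal.ofReal (Real.log ((boundaryDist x + dist x y) / boundaryDist x))
      ≤ ENNReal.ofReal (Real.log ((boundaryDist x + L) / boundaryDist x)) := by
        refine ENNReal.ofReal_le_ofReal (Real.log_le_log ?_ (by gcongr))
        positivity
    _ ≤ ∫⁻ t in Icc 0 L, (ENNReal.ofReal (boundaryDist x + t))⁻¹ :=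
        ofReal_log_le_lintegral_inv hx ENNReal.toReal_nonneg
    _ ≤ _ := by
        refine setLIntegral_mono' measurableSet_Icc fun t ht => ?_
        obtain ⟨r, hr, rfl⟩ := h.exists_curveLength_eq ht
        rw [h.naturalParameterization_apply hr]
        refine ENNReal.inv_le_inv.2 (ENNReal.ofReal_le_ofReal ?_)
        have h1 := boundaryDist_le_add_dist (γ r) x
        rw [dist_comm] at h1
        linarith [hdist r hr]

theorem quasihyperbolicDist_self (x : X) : quasihyperbolicDist x x = 0 := by
  have h : IsRectifiableCurve (fun _ : ℝ => x) 0 0 x x :=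
    ⟨⟨le_rfl, rfl, rfl, continuousOn_const⟩, by simp [curveLength_self]⟩
  refine le_antisymm ((iInf₂_le_of_le _ 0 (iInf₂_le 0 h)).trans ?_) zero_le
  simp [arcLengthIntegral, curveLength_self]

end QuasihyperbolicDistance

/-! ### Stability of quasigeodesic chains in Gromov hyperbolic spaces -/

section GromovHyperbolic

open Metric

variable {Y : Type*} [PseudoMetricSpace Y] {δ : ℝ}

namespace IsGeodesicArc

variable {α : ℝ → Y} {l : ℝ} {x y : Y}

theorem dist_apply (h : IsGeodesicArc edist α l x y) {s t : ℝ} (hs : s ∈ Icc 0 l)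
    (ht : t ∈ Icc 0 l) : dist (α s) (α t) = |s - t| := by
  rw [dist_edist, h.dist_eq s hs t ht, ENNReal.toReal_ofReal (abs_nonneg _)]

theorem length_eq (h : IsGeodesicArc edist α l x y) : l = dist x y := by
  have := h.dist_apply (left_mem_Icc.2 h.nonneg) (right_mem_Icc.2 h.nonneg)
  rw [h.left, h.right] at this
  rw [this, zero_sub, abs_neg, abs_of_nonneg h.nonneg]

theorem dist_left (h : IsGeodesicArc edist α l x y) {t : ℝ} (ht : t ∈ Icc 0 l) :
    dist (α t) x = t := by
  have := h.dist_apply ht (left_mem_Icc.2 h.nonneg)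
  rwa [h.left, sub_zero, abs_of_nonneg ht.1] at this

theorem dist_right (h : IsGeodesicArc edist α l x y) {t : ℝ} (ht : t ∈ Icc 0 l) :
    dist (α t) y = l - t := by
  have := h.dist_apply ht (right_mem_Icc.2 h.nonneg)
  rwa [h.right, abs_sub_comm, abs_of_nonneg (sub_nonneg.2 ht.2)] at this

theorem subarc (h : IsGeodesicArc edist α l x y) {s t : ℝ} (hs : 0 ≤ s) (hst : s ≤ t)
    (ht : t ≤ l) : IsGeodesicArc edist (fun r => α (s + r)) (t - s) (α s) (α t) where
  nonneg := sub_nonneg.2 hst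
  left := by simp
  right := by simp
  dist_eq p hp q hq := by
    rw [h.dist_eq _ ⟨by linarith [hp.1], by linarith [hp.2]⟩ _
      ⟨by linarith [hq.1], by linarith [hq.2]⟩]
    congr 2; ring

end IsGeodesicArc

theorem IsGeodesicArc.reverse {X : Type*} {ρ : X → X → ℝ≥0∞} {α : ℝ → X} {l : ℝ} {x y : X}
    (h : IsGeodesicArc ρ α l x y) : IsGeodesicArc ρ (fun t => α (l - t)) l y x where
  nonneg := h.nonneg
  left := by simp [h.right]
  right := by simp [h.left]
  dist_eq s hs t ht := by
    rw [h.dist_eq _ ⟨by linarith [hs.2], by linarith [hs.1]⟩ _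
      ⟨by linarith [ht.2], by linarith [ht.1]⟩, abs_sub_comm]
    congr 2; ring

namespace IsGromovHyperbolic

/-- The thin triangle condition in terms of real distances, the two other sides being traversed
from `x` to `y` through `z`. -/
theorem exists_dist_le (H : IsGromovHyperbolic δ (edist : Y → Y → ℝ≥0∞)) (hδ : 0 ≤ δ)
    {x y z : Y} {α β γ : ℝ → Y} {l m n : ℝ} (hα : IsGeodesicArc edist α l x y)
    (hβ : IsGeodesicArc edist β m x z) (hγ : IsGeodesicArc edist γ n z y) {t : ℝ}
    (ht : t ∈ Icc 0 l) :
    (∃ s ∈ Icc 0 m, dist (α t) (β s) ≤ δ) ∨ ∃ s ∈ Icc 0 n, dist (α t) (γ s) ≤ δ := by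
  obtain ⟨q, hq, hd⟩ := H.slim x y z _ _ _ l n m hα hγ.reverse hβ.reverse _ ⟨t, ht, rfl⟩
  rw [edist_le_ofReal hδ] at hd
  rcases hq with ⟨s, hs, rfl⟩ | ⟨s, hs, rfl⟩
  · exact Or.inr ⟨n - s, ⟨by linarith [hs.2], by linarith [hs.1]⟩, hd⟩
  · exact Or.inl ⟨m - s, ⟨by linarith [hs.2], by linarith [hs.1]⟩, hd⟩

/-- Halving a chain of `n ≤ 2 ^ m` steps and applying the thin triangle condition `m` times, a
geodesic between its ends stays logarithmically close to the chain. -/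
theorem exists_dist_chain_le (H : IsGromovHyperbolic δ (edist : Y → Y → ℝ≥0∞)) (hδ : 0 ≤ δ)
    {C : ℝ} {w : ℕ → Y} (m : ℕ) : ∀ (i n : ℕ), n ≤ 2 ^ m →
      (∀ j, i ≤ j → j < i + n → dist (w j) (w (j + 1)) ≤ C) → 0 ≤ C →
      ∀ {α : ℝ → Y} {l : ℝ}, IsGeodesicArc edist α l (w i) (w (i + n)) → ∀ t ∈ Icc 0 l,
      ∃ j, i ≤ j ∧ j ≤ i + n ∧ dist (α t) (w j) ≤ δ * m + C := by
  induction m with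
  | zero =>
    intro i n hn hw hC α l hα t ht
    refine ⟨i, le_rfl, by lia, ?_⟩
    rw [hα.dist_left ht]
    have hl := hα.length_eq
    obtain rfl | rfl : n = 0 ∨ n = 1 := by simp at hn; lia
    · simp only [add_zero, dist_self] at hl
      simp only [Nat.cast_zero]
      linarith [ht.2]
    · have := hw i le_rfl (by lia)
      simp only [Nat.cast_zero]
      linarith [ht.2]
  | succ m ih =>
    intro i n hn hw hC α l hα t ht
    obtain ⟨p, q, rfl, hp, hq⟩ : ∃ p q, n = p + q ∧ p ≤ 2 ^ m ∧ q ≤ 2 ^ m := by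
      rw [pow_succ] at hn
      exact ⟨n / 2, n - n / 2, by lia, by lia, by lia⟩
    obtain ⟨β, b, hβ⟩ := H.geodesic (w i) (w (i + p))
    obtain ⟨γ, c, hγ⟩ := H.geodesic (w (i + p)) (w (i + (p + q)))
    push_cast
    rcases H.exists_dist_le hδ hα hβ hγ ht with ⟨s, hs, hd⟩ | ⟨s, hs, hd⟩
    · obtain ⟨j, h1, h2, h3⟩ := ih i p hp (fun j h1 h2 => hw j h1 (by lia)) hC hβ s hs
      exact ⟨j, h1, by lia, by linarith [dist_triangle (α t) (β s) (w j)]⟩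
    · rw [← add_assoc] at hγ
      obtain ⟨j, h1, h2, h3⟩ := ih (i + p) q hq (fun j h1 h2 => hw j (by lia) (by lia)) hC hγ s hs
      exact ⟨j, by lia, by lia, by linarith [dist_triangle (α t) (γ s) (w j)]⟩

/-- The same bound for chain indices in either order. -/
theorem exists_dist_chain_le_of_le (H : IsGromovHyperbolic δ (edist : Y → Y → ℝ≥0∞)) (hδ : 0 ≤ δ)
    {C : ℝ} (hC : 0 ≤ C) {w : ℕ → Y} {m n : ℕ} (hw : ∀ j < n, dist (w j) (w (j + 1)) ≤ C)
    {i j : ℕ} (hi : i ≤ n) (hj : j ≤ n) (hij : i ≤ j + 2 ^ m) (hji : j ≤ i + 2 ^ m)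
    {α : ℝ → Y} {l : ℝ} (hα : IsGeodesicArc edist α l (w i) (w j)) {t : ℝ} (ht : t ∈ Icc 0 l) :
    ∃ k ≤ n, dist (α t) (w k) ≤ δ * m + C := by
  rcases le_total i j with h | h
  · obtain ⟨p, rfl⟩ := Nat.exists_eq_add_of_le h
    obtain ⟨k, -, h2, h3⟩ := H.exists_dist_chain_le hδ m i p (by lia)
      (fun j _ _ => hw j (by lia)) hC hα t ht
    exact ⟨k, by lia, h3⟩
  · obtain ⟨p, rfl⟩ := Nat.exists_eq_add_of_le h
    obtain ⟨k, -, h2, h3⟩ := H.exists_dist_chain_le hδ m j p (by lia)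
      (fun j _ _ => hw j (by lia)) hC hα.reverse (l - t) ⟨by linarith [ht.2], by linarith [ht.1]⟩
    exact ⟨k, by lia, by simpa using h3⟩

end IsGromovHyperbolic

theorem exists_forall_two_pow_le_linear (P Q : ℝ) :
    ∃ N : ℕ, ∀ m : ℕ, (2 : ℝ) ^ m ≤ P * m + Q → m ≤ N := by
  have h1 := (tendsto_pow_const_div_const_pow_of_one_lt 1 (one_lt_two (α := ℝ))).const_mul P
  have h0 := (tendsto_pow_const_div_const_pow_of_one_lt 0 (one_lt_two (α := ℝ))).const_mul Q
  have h := (h1.add h0).eventually_lt_const (u := 1) (by simp)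
  obtain ⟨N, hN⟩ := Filter.eventually_atTop.1 h
  refine ⟨N, fun m hm => ?_⟩
  by_contra! hlt
  have := hN m hlt.le
  have h2 : (0 : ℝ) < 2 ^ m := by positivity
  rw [pow_one, pow_zero, mul_div_assoc', mul_div_assoc', ← add_div, div_lt_one h2] at this
  linarith

namespace IsGromovHyperbolic

/-- If `D` is the largest distance from a geodesic to a chain joining its ends, then `D` is bounded
by a logarithm of itself: the subarc of length `4 D` around the farthest point is the base of a
quadrilateral whose two short sides are too far from that point, and whose top shadows a piece of
the chain with at most `2 ^ m` steps. -/
theorem exists_chain_excursion_le (H : IsGromovHyperbolic δ (edist : Y → Y → ℝ≥0∞)) (hδ : 0 ≤ δ)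
    {C c B : ℝ} (hC : 0 ≤ C) (hc : 0 < c) (hB : 0 ≤ B) {w : ℕ → Y} {n : ℕ}
    (hw : ∀ j < n, dist (w j) (w (j + 1)) ≤ C)
    (hlow : ∀ i j, i ≤ j → j ≤ n → c * ((j : ℝ) - i) - B ≤ dist (w i) (w j))
    {α : ℝ → Y} {l : ℝ} (hα : IsGeodesicArc edist α l (w 0) (w n)) :
    ∃ (D : ℝ) (m : ℕ), (∀ t ∈ Icc 0 l, ∃ j ≤ n, dist (α t) (w j) ≤ D) ∧
      D ≤ δ * (m + 2) + C ∧ (2 : ℝ) ^ m ≤ 2 * ((6 * D + B) / c + 1) := by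
  set S : Set Y := w '' Iic n with hS
  have hSc : IsCompact S := ((finite_Iic n).image w).isCompact
  have hSne : S.Nonempty := ⟨w 0, mem_image_of_mem w (Nat.zero_le n)⟩
  have hnear : ∀ p, ∃ j ≤ n, infDist p S = dist p (w j) := fun p => by
    obtain ⟨_, ⟨j, hj, rfl⟩, h⟩ := hSc.exists_infDist_eq_dist hSne p
    exact ⟨j, hj, h⟩
  have hle : ∀ p, ∀ j ≤ n, infDist p S ≤ dist p (w j) := fun p j hj =>
    infDist_le_dist_of_mem (mem_image_of_mem w hj)
  have hcont : ContinuousOn (fun t => infDist (α t) S) (Icc 0 l) := by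
    refine (continuous_infDist_pt S).comp_continuousOn ?_
    refine (LipschitzOnWith.of_dist_le_mul (K := 1) fun s hs t ht => ?_).continuousOn
    rw [hα.dist_apply hs ht, NNReal.coe_one, one_mul, Real.dist_eq]
  obtain ⟨t₀, ht₀, hmax⟩ := isCompact_Icc.exists_isMaxOn ⟨0, left_mem_Icc.2 hα.nonneg⟩ hcont
  set D := infDist (α t₀) S with hD
  have hD0 : 0 ≤ D := infDist_nonneg
  have hclose : ∀ t ∈ Icc 0 l, ∃ j ≤ n, dist (α t) (w j) ≤ D := fun t ht => by
    obtain ⟨j, hj, h⟩ := hnear (α t)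
    exact ⟨j, hj, h ▸ hmax ht⟩
  -- A geodesic from an end of the subarc to a nearby point of the chain stays at distance at
  -- least `D` from `α t₀`: it has length at most `D`, or length `0` if the end is an end of `α`.
  obtain ⟨i, u, hi, hu0, hut, hiu, hsideu⟩ : ∃ (i : ℕ) (u : ℝ), i ≤ n ∧ 0 ≤ u ∧ u ≤ t₀ ∧
      (dist (α u) (w i) ≤ D ∧ t₀ - u ≤ 2 * D) ∧
      ∀ (β : ℝ → Y) (b : ℝ), IsGeodesicArc edist β b (α u) (w i) → ∀ s ∈ Icc 0 b,
        D ≤ dist (α t₀) (β s) := by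
    rcases le_total (2 * D) t₀ with h | h
    · obtain ⟨i, hi, hiD⟩ := hclose (t₀ - 2 * D) ⟨by linarith, by linarith [ht₀.2]⟩
      refine ⟨i, t₀ - 2 * D, hi, by linarith, by linarith, ⟨hiD, by linarith⟩,
        fun β b hβ s hs => ?_⟩
      have h1 := hα.dist_apply ht₀ (t := t₀ - 2 * D) ⟨by linarith, by linarith [ht₀.2]⟩
      rw [sub_sub_cancel, abs_of_nonneg (by linarith)] at h1
      have h2 := hβ.dist_left hs
      have h3 := hβ.length_eq
      linarith [dist_triangle (α t₀) (β s) (α (t₀ - 2 * D)), hs.2]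
    · refine ⟨0, 0, Nat.zero_le n, le_rfl, ht₀.1, ⟨by rw [hα.left, dist_self]; exact hD0,
        by linarith⟩, fun β b hβ s hs => ?_⟩
      have h2 := hβ.dist_right hs
      have h3 := hβ.length_eq
      rw [hα.left, dist_self] at h3
      linarith [dist_triangle (α t₀) (β s) (w 0), hs.1, hle (α t₀) 0 (Nat.zero_le n)]
  obtain ⟨j, v, hj, hvl, hvt, hjv, hsidev⟩ : ∃ (j : ℕ) (v : ℝ), j ≤ n ∧ v ≤ l ∧ t₀ ≤ v ∧
      (dist (α v) (w j) ≤ D ∧ v - t₀ ≤ 2 * D) ∧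
      ∀ (β : ℝ → Y) (b : ℝ), IsGeodesicArc edist β b (w j) (α v) → ∀ s ∈ Icc 0 b,
        D ≤ dist (α t₀) (β s) := by
    rcases le_total (t₀ + 2 * D) l with h | h
    · obtain ⟨j, hj, hjD⟩ := hclose (t₀ + 2 * D) ⟨by linarith [ht₀.1], by linarith⟩
      refine ⟨j, t₀ + 2 * D, hj, by linarith, by linarith, ⟨hjD, by linarith⟩,
        fun β b hβ s hs => ?_⟩
      have h1 := hα.dist_apply ht₀ (t := t₀ + 2 * D) ⟨by linarith [ht₀.1], by linarith⟩
      rw [sub_add_cancel_left, abs_neg, abs_of_nonneg (by linarith)] at h1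
      have h2 := hβ.dist_right hs
      have h3 := hβ.length_eq
      rw [dist_comm] at h3
      linarith [dist_triangle (α t₀) (β s) (α (t₀ + 2 * D)), hs.1]
    · refine ⟨n, l, le_rfl, le_rfl, ht₀.2, ⟨by rw [hα.right, dist_self]; exact hD0,
        by linarith⟩, fun β b hβ s hs => ?_⟩
      have h2 := hβ.dist_left hs
      have h3 := hβ.length_eq
      rw [hα.right, dist_self] at h3
      linarith [dist_triangle (α t₀) (β s) (w n), hs.2, hle (α t₀) n le_rfl]
  have hwij : dist (w i) (w j) ≤ 6 * D := by
    have h1 := hα.dist_apply (s := u) (t := v) ⟨hu0, by linarith⟩ ⟨by linarith, hvl⟩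
    rw [abs_sub_comm, abs_of_nonneg (by linarith)] at h1
    have h2 := dist_triangle4 (w i) (α u) (α v) (w j)
    rw [dist_comm (w i) (α u)] at h2
    linarith [hiu.1, hiu.2, hjv.1, hjv.2]
  set q : ℝ := (6 * D + B) / c with hq
  have hq0 : 0 ≤ q := by positivity
  have hstep : ∀ a b : ℕ, a ≤ b → b ≤ n → dist (w a) (w b) ≤ 6 * D → b ≤ a + ⌈q⌉₊ := by
    intro a b hab hbn hd
    have h1 := hlow a b hab hbn
    have h2 : (b : ℝ) - a ≤ q := by
      rw [hq, le_div_iff₀ hc]; linarith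
    have h3 := Nat.le_ceil q
    have : (b : ℝ) ≤ a + ⌈q⌉₊ := by linarith
    exact_mod_cast this
  set m := Nat.clog 2 ⌈q⌉₊ with hm
  have hm1 : ⌈q⌉₊ ≤ 2 ^ m := Nat.le_pow_clog one_lt_two _
  have hm2 : (2 : ℝ) ^ m ≤ 2 * (q + 1) := by
    rcases Nat.eq_zero_or_pos m with h0 | h0
    · rw [h0, pow_zero]; linarith
    · have h1 : 1 < ⌈q⌉₊ := by
        by_contra! h
        rw [hm, Nat.clog_of_right_le_one h] at h0
        exact lt_irrefl _ h0
      have h2 : 2 ^ m.pred < ⌈q⌉₊ := Nat.pow_pred_clog_lt_self one_lt_two h1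
      have h3 : ((2 ^ m.pred : ℕ) : ℝ) < ⌈q⌉₊ := by exact_mod_cast h2
      have h4 := Nat.ceil_lt_add_one hq0
      have h5 : m = m.pred + 1 := (Nat.succ_pred_eq_of_pos h0).symm
      rw [h5, pow_succ]
      push_cast at h3
      linarith
  refine ⟨D, m, hclose, ?_, hm2⟩
  have hij : i ≤ j + 2 ^ m ∧ j ≤ i + 2 ^ m := by
    rcases le_total i j with h | h
    · have := hstep i j h hj hwij
      exact ⟨by lia, by lia⟩
    · have := hstep j i h hi (by rwa [dist_comm])
      exact ⟨by lia, by lia⟩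
  obtain ⟨β, b, hβ⟩ := H.geodesic (α u) (w j)
  obtain ⟨γ, g, hγ⟩ := H.geodesic (w j) (α v)
  obtain ⟨β', b', hβ'⟩ := H.geodesic (α u) (w i)
  obtain ⟨η, e, hη⟩ := H.geodesic (w i) (w j)
  have hsub := hα.subarc hu0 (hut.trans hvt) hvl
  have hmδ : 0 ≤ δ * m := by positivity
  have ht : t₀ - u ∈ Icc 0 (v - u) := ⟨by linarith, by linarith⟩
  have key := H.exists_dist_le hδ hsub hβ hγ ht
  simp only [add_sub_cancel] at key
  rcases key with ⟨s, hs, hd⟩ | ⟨s, hs, hd⟩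
  · rcases H.exists_dist_le hδ hβ hβ' hη hs with ⟨r, hr, hd'⟩ | ⟨r, hr, hd'⟩
    · have h1 := hsideu β' b' hβ' r hr
      linarith [dist_triangle (α t₀) (β s) (β' r)]
    · obtain ⟨k, hk, hd''⟩ := H.exists_dist_chain_le_of_le hδ hC hw hi hj hij.1 hij.2 hη hr
      have h1 := hle (α t₀) k hk
      linarith [dist_triangle4 (α t₀) (β s) (η r) (w k)]
  · have h1 := hsidev γ g hγ s hs
    linarith

end IsGromovHyperbolic

/-- **Stability of quasigeodesics**: in a Gromov hyperbolic space a geodesic stays within bounded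
distance of any quasigeodesic chain `w 0, …, w n` with the same ends. -/
theorem exists_quasigeodesic_chain_bound {C c B : ℝ} (hδ : 0 ≤ δ) (hC : 0 ≤ C) (hc : 0 < c)
    (hB : 0 ≤ B) :
    ∃ R : ℝ, 0 ≤ R ∧ ∀ (Y : Type*) [PseudoMetricSpace Y],
      IsGromovHyperbolic δ (edist : Y → Y → ℝ≥0∞) → ∀ (w : ℕ → Y) (n : ℕ),
      (∀ j < n, dist (w j) (w (j + 1)) ≤ C) →
      (∀ i j, i ≤ j → j ≤ n → c * ((j : ℝ) - i) - B ≤ dist (w i) (w j)) →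
      ∀ (α : ℝ → Y) (l : ℝ), IsGeodesicArc edist α l (w 0) (w n) →
      ∀ t ∈ Icc 0 l, ∃ j ≤ n, dist (α t) (w j) ≤ R := by
  obtain ⟨N, hN⟩ := exists_forall_two_pow_le_linear (12 * δ / c)
    (2 * ((6 * (2 * δ + C) + B) / c + 1))
  refine ⟨δ * (N + 2) + C, by positivity, ?_⟩
  intro Y _ H w n hw hlow α l hα t ht
  obtain ⟨D, m, hclose, hDm, hm⟩ := H.exists_chain_excursion_le hδ hC hc hB hw hlow hα
  have hmN : m ≤ N := by
    refine hN m (hm.trans ?_)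
    have : (6 * D + B) / c ≤ (6 * (δ * (m + 2) + C) + B) / c := by gcongr
    calc 2 * ((6 * D + B) / c + 1) ≤ 2 * ((6 * (δ * (m + 2) + C) + B) / c + 1) := by linarith
      _ = _ := by field_simp; ring
  obtain ⟨j, hj, hd⟩ := hclose t ht
  refine ⟨j, hj, hd.trans (hDm.trans ?_)⟩
  have : (m : ℝ) ≤ N := by exact_mod_cast hmN
  gcongr

/-- A geodesic follows a quasigeodesic chain with the same ends monotonically: earlier points are
close to earlier points of the chain. This is `exists_quasigeodesic_chain_bound` applied a second
time, to the geodesic up to `α t` and to the chain up to a point close to `α t`, followed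
by `α t` itself. -/
theorem exists_monotone_quasigeodesic_chain_bound {C c B : ℝ} (hδ : 0 ≤ δ) (hC : 0 ≤ C)
    (hc : 0 < c) (hB : 0 ≤ B) :
    ∃ R : ℝ, 0 ≤ R ∧ ∀ (Y : Type*) [PseudoMetricSpace Y],
      IsGromovHyperbolic δ (edist : Y → Y → ℝ≥0∞) → ∀ (w : ℕ → Y) (n : ℕ),
      (∀ j < n, dist (w j) (w (j + 1)) ≤ C) →
      (∀ i j, i ≤ j → j ≤ n → c * ((j : ℝ) - i) - B ≤ dist (w i) (w j)) →
      ∀ (α : ℝ → Y) (l : ℝ), IsGeodesicArc edist α l (w 0) (w n) →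
      ∀ s t : ℝ, 0 ≤ s → s ≤ t → t ≤ l →
        ∃ i j, i ≤ j ∧ j ≤ n ∧ dist (α s) (w i) ≤ R ∧ dist (α t) (w j) ≤ R := by
  obtain ⟨R, hR0, hR⟩ := exists_quasigeodesic_chain_bound hδ hC hc hB
  obtain ⟨R', hR0', hR'⟩ := exists_quasigeodesic_chain_bound (C := max C R) (c := c)
    (B := B + R + c) hδ (le_max_of_le_left hC) hc (by positivity)
  refine ⟨R' + R, by positivity, ?_⟩
  intro Y _ H w n hw hlow α l hα s t hs hst htl
  obtain ⟨j, hj, hjR⟩ := hR Y H w n hw hlow α l hα t ⟨hs.trans hst, htl⟩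
  set v : ℕ → Y := fun k => if k ≤ j then w k else α t with hv
  have hvle : ∀ k ≤ j, v k = w k := fun k hk => by simp [hv, hk]
  have hvlast : v (j + 1) = α t := by simp [hv]
  have hstep : ∀ k < j + 1, dist (v k) (v (k + 1)) ≤ max C R := by
    intro k hk
    rcases Nat.lt_succ_iff_lt_or_eq.1 hk with h | rfl
    · rw [hvle k h.le, hvle (k + 1) h]
      exact (hw k (by lia)).trans (le_max_left _ _)
    · rw [hvle k le_rfl, hvlast, dist_comm]
      exact hjR.trans (le_max_right _ _)
  have hvlow : ∀ p q, p ≤ q → q ≤ j + 1 → c * ((q : ℝ) - p) - (B + R + c) ≤ dist (v p) (v q) := by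
    intro p q hpq hq
    rcases Nat.le_succ_iff_eq_or_le.1 hq with rfl | h
    · rcases Nat.le_succ_iff_eq_or_le.1 hpq with rfl | hp
      · rw [sub_self, mul_zero, dist_self]; linarith
      · rw [hvle p hp, hvlast]
        have h1 := hlow p j hp hj
        have h2 := dist_triangle (w p) (α t) (w j)
        push_cast
        linarith
    · rw [hvle q h, hvle p (hpq.trans h)]
      linarith [hlow p q hpq (h.trans hj)]
  have hsub := hα.subarc le_rfl (hs.trans hst) htl
  rw [hα.left, ← hvle 0 (Nat.zero_le j), ← hvlast] at hsub
  obtain ⟨k, hk, hkR⟩ := hR' Y H v (j + 1) hstep hvlow _ _ hsub s ⟨hs, by linarith⟩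
  rw [zero_add] at hkR
  rcases Nat.le_succ_iff_eq_or_le.1 hk with rfl | h
  · rw [hvlast] at hkR
    exact ⟨j, j, le_rfl, hj, by linarith [dist_triangle (α s) (α t) (w j)], by linarith⟩
  · rw [hvle k h] at hkR
    exact ⟨k, j, h, hj, by linarith, by linarith⟩

end GromovHyperbolic

/-! ### Cone arcs as chains -/

section ConeArcChain

variable {X : Type*} [MetricSpace X] {γ : ℝ → X} {a u v : ℝ} {x x₀ : X}

/-- A cone arc, sampled at arc lengths `2 ^ j * d(x) / 4` from `x`, is a chain whose steps are
bounded in the quasihyperbolic metric, and along which `d` doubles at each step up to a constant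
factor. -/
theorem IsConeArc.exists_chain (hX : ∀ z : X, 0 < boundaryDist z) (ha : 1 ≤ a)
    (h : IsConeArc a γ u v x x₀) :
    ∃ (w : ℕ → X) (n : ℕ), w 0 = x ∧ w n = x₀ ∧
      (∀ j < n, quasihyperbolicDist (w j) (w (j + 1)) ≤ ENNReal.ofReal a) ∧
      ∀ j ≤ n, 2 ^ j * (boundaryDist x / (8 * a)) ≤ boundaryDist (w j) ∧
        boundaryDist (w j) ≤ 2 ^ j * (2 * boundaryDist x) := by
  have ha0 : 0 < a := by linarith
  have hrect : IsRectifiableCurve γ u v x x₀ :=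
    ⟨h.isCurve, ne_top_of_le_ne_top ENNReal.ofReal_ne_top
      (h.length_le v (right_mem_Icc.2 h.isCurve.le))⟩
  have huv := h.isCurve.le
  set V : ℝ → ℝ := fun r => (curveLength γ u r).toReal with hV
  set b := boundaryDist x with hb
  have hb0 : 0 < b := hX x
  have hV0 : ∀ r, 0 ≤ V r := fun r => ENNReal.toReal_nonneg
  have hcone : ∀ r ∈ Icc u v, V r ≤ a * boundaryDist (γ r) := fun r hr =>
    ENNReal.toReal_le_of_le_ofReal (mul_nonneg ha0.le (hX _).le) (h.length_le r hr)
  have hdist : ∀ r ∈ Icc u v, dist x (γ r) ≤ V r := by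
    intro r hr
    rw [← h.isCurve.left, dist_edist]
    exact ENNReal.toReal_mono (hrect.curveLength_ne_top le_rfl hr.2)
      (edist_le_curveLength γ hr.1)
  have hlow : ∀ r ∈ Icc u v, b - V r ≤ boundaryDist (γ r) := fun r hr => by
    linarith [hdist r hr, boundaryDist_le_add_dist x (γ r)]
  have hupp : ∀ r ∈ Icc u v, boundaryDist (γ r) ≤ b + V r := fun r hr => by
    have := boundaryDist_le_add_dist (γ r) x
    rw [dist_comm] at this
    linarith [hdist r hr]
  have hVmono : ∀ r ∈ Icc u v, ∀ s ∈ Icc u v, r ≤ s → V r ≤ V s := fun r hr s hs hrs =>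
    ENNReal.toReal_mono (hrect.curveLength_ne_top le_rfl hs.2)
      (curveLength_mono γ (Icc_subset_Icc_right hrs))
  have hsub : ∀ r ∈ Icc u v, ∀ s ∈ Icc u v, r ≤ s → (curveLength γ r s).toReal = V s - V r := by
    intro r hr s hs hrs
    rw [hV]
    dsimp only
    rw [← curveLength_add γ hr.1 hrs, ENNReal.toReal_add
      (hrect.curveLength_ne_top le_rfl hr.2) (hrect.curveLength_ne_top hr.1 hs.2),
      add_sub_cancel_left]
  set L := V v with hL
  have hr : ∀ j : ℕ, ∃ r ∈ Icc u v, V r = min (2 ^ j * (b / 4)) L := fun j =>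
    hrect.exists_curveLength_eq ⟨le_min (by positivity) (hV0 v), min_le_right _ _⟩
  choose r hr hVr using hr
  have hex : ∃ n : ℕ, 1 ≤ n ∧ L ≤ 2 ^ n * (b / 4) := by
    obtain ⟨n, hn⟩ := pow_unbounded_of_one_lt (L / (b / 4)) one_lt_two
    refine ⟨n + 1, by lia, ?_⟩
    rw [div_lt_iff₀ (by positivity)] at hn
    have : (2 : ℝ) ^ n * (b / 4) ≤ 2 ^ (n + 1) * (b / 4) := by
      gcongr
      · norm_num
      · lia
    linarith
  classical
  set n := Nat.find hex with hn
  obtain ⟨hn1, hnL⟩ := Nat.find_spec hex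
  rw [← hn] at hn1 hnL
  -- Before the last sample the arc has not been exhausted.
  have hlt : ∀ j, 1 ≤ j → j < n → 2 ^ j * (b / 4) < L := fun j hj hjn => by
    by_contra! hcon
    exact Nat.find_min hex hjn ⟨hj, hcon⟩
  have hVeq : ∀ j, 1 ≤ j → j < n → V (r j) = 2 ^ j * (b / 4) := fun j hj hjn => by
    rw [hVr, min_eq_left (hlt j hj hjn).le]
  have hVle : ∀ j, V (r j) ≤ 2 ^ j * (b / 4) := fun j => by
    rw [hVr]; exact min_le_left _ _
  have hpow : ∀ j : ℕ, (1 : ℝ) ≤ 2 ^ j := fun j => one_le_pow₀ one_le_two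
  refine ⟨fun j => if j = 0 then x else γ (r j), n, by simp, ?_, ?_, ?_⟩
  · dsimp only
    rw [if_neg (by lia), ← h.isCurve.right]
    refine hrect.eq_of_curveLength_eq (hr n) (right_mem_Icc.2 huv) ?_
    change V (r n) = V v
    rw [hVr, min_eq_right hnL]
  · intro j hj
    dsimp only
    rw [if_neg (Nat.succ_ne_zero j)]
    rcases Nat.eq_zero_or_pos j with rfl | hj0
    · rw [if_pos rfl]
      have h1 := hVle 1
      have hc := hrect.subcurve le_rfl (hr 1).1 (hr 1).2
      rw [h.isCurve.left] at hc
      refine (hc.quasihyperbolicDist_le (L := b / 2) (m := b / 2) (by positivity) ?_ ?_).trans ?_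
      · change V (r 1) ≤ b / 2
        linarith
      · intro s hs
        have hs' : s ∈ Icc u v := ⟨hs.1, hs.2.trans (hr 1).2⟩
        linarith [hlow s hs', hVmono s hs' (r 1) (hr 1) hs.2]
      · rw [div_self (by positivity)]
        exact ENNReal.ofReal_le_ofReal ha
    · rw [if_neg (by lia)]
      have h1 := hVeq j hj0 hj
      have h2 := hVle (j + 1)
      rw [pow_succ] at h2
      have hlt' : V (r j) < V (r (j + 1)) := by
        rw [h1, hVr, lt_min_iff]
        refine ⟨?_, hlt j hj0 hj⟩
        rw [pow_succ]
        nlinarith [hpow j]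
      have hle : r j ≤ r (j + 1) := by
        by_contra! hcon
        exact hlt'.not_ge (hVmono _ (hr _) _ (hr _) hcon.le)
      have hpos : 0 < V (r j) := by rw [h1]; positivity
      refine ((hrect.subcurve (hr j).1 hle (hr (j + 1)).2).quasihyperbolicDist_le (L := V (r j))
        (m := V (r j) / a) (by positivity) ?_ ?_).trans ?_
      · rw [hsub _ (hr _) _ (hr _) hle]
        linarith
      · intro s hs
        have hs' : s ∈ Icc u v := ⟨(hr j).1.trans hs.1, hs.2.trans (hr (j + 1)).2⟩
        rw [div_le_iff₀ ha0]
        linarith [hcone s hs', hVmono _ (hr j) _ hs' hs.1]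
      · rw [div_div_cancel₀ hpos.ne']
  · intro j hj
    dsimp only
    rcases Nat.eq_zero_or_pos j with rfl | hj0
    · rw [if_pos rfl, pow_zero, one_mul, one_mul]
      exact ⟨div_le_self hb0.le (by linarith), by linarith⟩
    · rw [if_neg (by lia)]
      have h1 := hVle j
      constructor
      · have h2 : 2 ^ j * (b / (8 * a)) = 2 ^ j * (b / 8) / a := by field_simp
        rw [h2, div_le_iff₀ ha0]
        obtain rfl | hj2 : j = 1 ∨ 2 ≤ j := by lia
        · have h3 := hlow _ (hr 1)
          have h4 := mul_le_mul_of_nonneg_right ha (hX (γ (r 1))).le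
          linarith
        · have h3 := hcone _ (hr j)
          have h4 : 2 ^ j * (b / 8) ≤ V (r j) := by
            rw [hVr]
            have h5 := hlt (j - 1) (by lia) (by lia)
            have h6 : (2 : ℝ) ^ j = 2 ^ (j - 1) * 2 := by
              rw [← pow_succ]; congr 1; lia
            refine le_min (by gcongr; norm_num) ?_
            rw [h6]
            linarith
          linarith
      · have h3 := hupp _ (hr j)
        nlinarith [hpow j]

end ConeArcChain

/-! ### Growth of the boundary distance along quasihyperbolic geodesics -/

section QuasihyperbolicGeometry

variable {X : Type*} [MetricSpace X] {δ : ℝ}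

namespace IsGromovHyperbolic

/-- Finiteness and symmetry of `k` can be read off a geodesic. -/
theorem quasihyperbolicDist_ne_top
    (H : IsGromovHyperbolic δ (quasihyperbolicDist : X → X → ℝ≥0∞)) (x y : X) :
    quasihyperbolicDist x y ≠ ∞ := by
  obtain ⟨α, l, hα⟩ := H.geodesic x y
  have h := hα.dist_eq 0 (left_mem_Icc.2 hα.nonneg) l (right_mem_Icc.2 hα.nonneg)
  rw [hα.left, hα.right] at h
  rw [h]
  exact ENNReal.ofReal_ne_top

theorem quasihyperbolicDist_comm
    (H : IsGromovHyperbolic δ (quasihyperbolicDist : X → X → ℝ≥0∞)) (x y : X) :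
    quasihyperbolicDist x y = quasihyperbolicDist y x := by
  obtain ⟨α, l, hα⟩ := H.geodesic x y
  have h0 := left_mem_Icc.2 hα.nonneg
  have hl := right_mem_Icc.2 hα.nonneg
  have h := hα.dist_eq 0 h0 l hl
  rw [abs_sub_comm, ← hα.dist_eq l hl 0 h0, hα.left, hα.right] at h
  exact h

/-- The space `(X, k)`. -/
@[reducible] noncomputable def quasihyperbolicPseudoMetricSpace
    (H : IsGromovHyperbolic δ (quasihyperbolicDist : X → X → ℝ≥0∞)) : PseudoMetricSpace X :=
  @PseudoEMetricSpace.toPseudoMetricSpace X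
    { edist := quasihyperbolicDist
      edist_self := quasihyperbolicDist_self
      edist_comm := H.quasihyperbolicDist_comm
      edist_triangle := quasihyperbolicDist_triangle } H.quasihyperbolicDist_ne_top

theorem dist_le_mul_exp_sub_one
    (H : IsGromovHyperbolic δ (quasihyperbolicDist : X → X → ℝ≥0∞)) {x : X}
    (hx : 0 < boundaryDist x) (y : X) :
    dist x y ≤ boundaryDist x * (Real.exp (quasihyperbolicDist x y).toReal - 1) := by
  have h := (ENNReal.ofReal_le_iff_le_toReal (H.quasihyperbolicDist_ne_top x y)).1
    (ofReal_log_le_quasihyperbolicDist hx y)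
  rw [Real.log_le_iff_le_exp (by positivity), div_le_iff₀ hx] at h
  linarith

theorem boundaryDist_le_exp_mul
    (H : IsGromovHyperbolic δ (quasihyperbolicDist : X → X → ℝ≥0∞)) {x : X}
    (hx : 0 < boundaryDist x) (y : X) :
    boundaryDist y ≤ Real.exp (quasihyperbolicDist x y).toReal * boundaryDist x := by
  have h1 := H.dist_le_mul_exp_sub_one hx y
  have h2 := boundaryDist_le_add_dist y x
  rw [dist_comm] at h2
  linarith

end IsGromovHyperbolic

/-- Along a quasihyperbolic geodesic from `x` to the John center, `d` grows exponentially in the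
quasihyperbolic length: the geodesic monotonically follows the chain on a cone arc from `x`, which
is quasigeodesic because its steps are bounded while `d`, and with it `exp k`, doubles. -/
theorem exists_boundaryDist_le_exp_neg_mul (a δ : ℝ) (ha : 1 ≤ a) (hδ : 0 ≤ δ) :
    ∃ A ε : ℝ, 0 < A ∧ 0 < ε ∧ ∀ (X : Type*) [MetricSpace X],
      (∀ z : X, 0 < boundaryDist z) → ∀ x₀ : X, IsJohnWithCenter a x₀ →
      IsGromovHyperbolic δ (quasihyperbolicDist : X → X → ℝ≥0∞) →
      ∀ (x : X) (α : ℝ → X) (l : ℝ), IsQuasihyperbolicGeodesic α l x x₀ →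
      ∀ s t : ℝ, 0 ≤ s → s ≤ t → t ≤ l →
        boundaryDist (α s) ≤ A * Real.exp (-(ε * (t - s))) * boundaryDist (α t) := by
  have ha0 : 0 < a := by linarith
  have hlog2 : 0 < Real.log 2 := Real.log_pos one_lt_two
  obtain ⟨R, hR0, hR⟩ := exists_monotone_quasigeodesic_chain_bound (c := Real.log 2)
    (B := Real.log (16 * a)) hδ ha0.le hlog2 (Real.log_nonneg (by linarith))
  refine ⟨Real.exp R * Real.exp R * (16 * a) * Real.exp (Real.log 2 / a * (2 * R)),
    Real.log 2 / a, by positivity, by positivity, ?_⟩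
  intro X _ hX x₀ hJ H x α l hα s t hs hst htl
  obtain ⟨γ, u, v, hγ⟩ := hJ x
  obtain ⟨w, n, hw0, hwn, hstep, hd⟩ := hγ.exists_chain hX ha
  set b := boundaryDist x with hb
  have hb0 : 0 < b := hX x
  let K : X → X → ℝ := fun y z => (quasihyperbolicDist y z).toReal
  have hKcomm : ∀ y z, K y z = K z y := fun y z => by
    simp only [K, H.quasihyperbolicDist_comm y z]
  have hKtri : ∀ y z z', K y z' ≤ K y z + K z z' := fun y z z' =>
    @dist_triangle X H.quasihyperbolicPseudoMetricSpace y z z'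
  have hstepK : ∀ j < n, K (w j) (w (j + 1)) ≤ a := fun j hj =>
    ENNReal.toReal_le_of_le_ofReal ha0.le (hstep j hj)
  -- The constant `16 * a` is the ratio of the two bounds for `d` along the chain.
  have hratio : ∀ i j, i ≤ j → j ≤ n →
      Real.exp (Real.log 2 * ((j : ℝ) - i)) * boundaryDist (w i) ≤
        16 * a * boundaryDist (w j) := by
    intro i j hij hj
    have h1 := (hd i (hij.trans hj)).2
    have h2 := (hd j hj).1
    have h3 : Real.exp (Real.log 2 * ((j : ℝ) - i)) * 2 ^ i = 2 ^ j := by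
      rw [← Nat.cast_sub hij, mul_comm, mul_comm (Real.log 2), Real.exp_nat_mul,
        Real.exp_log two_pos, ← pow_add]
      congr 1; lia
    calc Real.exp (Real.log 2 * ((j : ℝ) - i)) * boundaryDist (w i)
        ≤ Real.exp (Real.log 2 * ((j : ℝ) - i)) * (2 ^ i * (2 * b)) := by gcongr
      _ = 16 * a * (2 ^ j * (b / (8 * a))) := by
        rw [← mul_assoc, h3]; field_simp; ring
      _ ≤ 16 * a * boundaryDist (w j) := by gcongr
  -- The chain is quasigeodesic, since `k` is at least the difference of the logarithms of `d`.
  have hlow : ∀ i j, i ≤ j → j ≤ n →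
      Real.log 2 * ((j : ℝ) - i) - Real.log (16 * a) ≤ K (w i) (w j) := by
    intro i j hij hj
    have h1 := hratio i j hij hj
    have h2 := H.boundaryDist_le_exp_mul (hX (w i)) (w j)
    have h3 : Real.exp (Real.log 2 * ((j : ℝ) - i)) ≤ 16 * a * Real.exp (K (w i) (w j)) := by
      refine le_of_mul_le_mul_right (h1.trans ?_) (hX (w i))
      rw [mul_assoc (16 * a)]
      exact mul_le_mul_of_nonneg_left h2 (by positivity)
    rw [← Real.log_le_log_iff (Real.exp_pos _) (by positivity), Real.log_exp,
      Real.log_mul (by positivity) (by positivity), Real.log_exp] at h3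
    linarith
  have hα' : IsGeodesicArc quasihyperbolicDist α l (w 0) (w n) := by
    rw [hw0, hwn]; exact hα
  obtain ⟨i, j, hij, hj, hsi, htj⟩ : ∃ i j, i ≤ j ∧ j ≤ n ∧ K (α s) (w i) ≤ R ∧
      K (α t) (w j) ≤ R :=
    @hR X H.quasihyperbolicPseudoMetricSpace H w n hstepK hlow α l hα' s t hs hst htl
  have hchain : ∀ q, i + q ≤ n → K (w i) (w (i + q)) ≤ a * q := by
    intro q
    induction q with
    | zero => intro _; simp [K, quasihyperbolicDist_self]
    | succ q ih =>
      intro hq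
      have h1 := ih (by lia)
      have h2 := hstepK (i + q) (by lia)
      have h3 := hKtri (w i) (w (i + q)) (w (i + q + 1))
      push_cast
      rw [← add_assoc]
      linarith
  have hts : t - s ≤ 2 * R + a * ((j : ℝ) - i) := by
    have h1 : K (α s) (α t) = t - s := by
      simp only [K]
      rw [hα.dist_eq s ⟨hs, hst.trans htl⟩ t ⟨hs.trans hst, htl⟩,
        ENNReal.toReal_ofReal (abs_nonneg _), abs_sub_comm, abs_of_nonneg (sub_nonneg.2 hst)]
    have h2 := hchain (j - i) (by lia)
    rw [Nat.add_sub_cancel' hij, Nat.cast_sub hij] at h2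
    linarith [hKtri (α s) (w i) (α t), hKtri (w i) (w j) (α t), hKcomm (α t) (w j)]
  have e1 : boundaryDist (α s) ≤ Real.exp R * boundaryDist (w i) := by
    refine (H.boundaryDist_le_exp_mul (hX (w i)) (α s)).trans ?_
    have := hX (w i)
    gcongr
    exact (hKcomm _ _).trans_le hsi
  have e2 : boundaryDist (w j) ≤ Real.exp R * boundaryDist (α t) := by
    refine (H.boundaryDist_le_exp_mul (hX (α t)) (w j)).trans ?_
    have := hX (α t)
    gcongr
  have e3 : boundaryDist (w i) ≤
      16 * a * Real.exp (-(Real.log 2 * ((j : ℝ) - i))) * boundaryDist (w j) := by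
    have h := mul_le_mul_of_nonneg_left (hratio i j hij hj)
      (Real.exp_pos (-(Real.log 2 * ((j : ℝ) - i)))).le
    rw [← mul_assoc, ← Real.exp_add, neg_add_cancel, Real.exp_zero, one_mul] at h
    linarith
  have e4 : Real.exp (-(Real.log 2 * ((j : ℝ) - i))) ≤
      Real.exp (Real.log 2 / a * (2 * R)) * Real.exp (-(Real.log 2 / a * (t - s))) := by
    rw [← Real.exp_add, Real.exp_le_exp]
    have h1 : Real.log 2 / a * (t - s) ≤ Real.log 2 / a * (2 * R + a * ((j : ℝ) - i)) := by
      gcongr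
    have h2 : Real.log 2 / a * (a * ((j : ℝ) - i)) = Real.log 2 * ((j : ℝ) - i) := by
      field_simp
    linarith
  have := hX (w j)
  have := hX (α t)
  calc boundaryDist (α s) ≤ Real.exp R * boundaryDist (w i) := e1
    _ ≤ Real.exp R * (16 * a * (Real.exp (Real.log 2 / a * (2 * R)) *
          Real.exp (-(Real.log 2 / a * (t - s)))) * (Real.exp R * boundaryDist (α t))) := by
        gcongr
        refine e3.trans ?_
        gcongr
    _ = _ := by ring

end QuasihyperbolicGeometry

/-! ### Length from a local bound -/

section Variation

variable {X : Type*} [PseudoMetricSpace X] {f : ℝ → X} {F : ℝ → ℝ} {p q : ℝ}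

theorem dist_le_sub_of_locally_dist_le_sub
    (h : ∀ s t, p ≤ s → s ≤ t → t ≤ q → t - s ≤ 1 → dist (f s) (f t) ≤ F t - F s) {s t : ℝ}
    (hs : p ≤ s) (hst : s ≤ t) (ht : t ≤ q) : dist (f s) (f t) ≤ F t - F s := by
  suffices ∀ (n : ℕ) (t : ℝ), s ≤ t → t ≤ q → t - s ≤ n → dist (f s) (f t) ≤ F t - F s from
    this ⌈t - s⌉₊ t hst ht (Nat.le_ceil _)
  intro n
  induction n with
  | zero =>
    intro t hst ht hn
    exact h s t hs hst ht (hn.trans (by simp))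
  | succ n ih =>
    intro t hst ht hn
    push_cast at hn
    rcases le_total (t - s) 1 with h1 | h1
    · exact h s t hs hst ht h1
    · have h2 := ih (t - 1) (by linarith) (by linarith) (by linarith)
      have h3 := h (t - 1) t (by linarith) (by linarith) ht (by linarith)
      linarith [dist_triangle (f s) (f (t - 1)) (f t)]

theorem eVariationOn_Icc_le_of_dist_le_sub
    (h : ∀ s t, p ≤ s → s ≤ t → t ≤ q → dist (f s) (f t) ≤ F t - F s) :
    eVariationOn f (Icc p q) ≤ ENNReal.ofReal (F q - F p) := by
  have hF : ∀ s t, p ≤ s → s ≤ t → t ≤ q → F s ≤ F t := fun s t h1 h2 h3 =>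
    sub_nonneg.1 (dist_nonneg.trans (h s t h1 h2 h3))
  refine iSup_le fun ⟨n, u, hu, us⟩ => ?_
  have hle : ∀ i, u i ≤ u (i + 1) := fun i => hu (Nat.le_succ i)
  calc ∑ i ∈ Finset.range n, edist (f (u (i + 1))) (f (u i))
      ≤ ∑ i ∈ Finset.range n, ENNReal.ofReal (F (u (i + 1)) - F (u i)) := by
        refine Finset.sum_le_sum fun i _ => ?_
        rw [edist_comm, edist_dist]
        exact ENNReal.ofReal_le_ofReal (h _ _ (us i).1 (hle i) (us (i + 1)).2)
    _ = ENNReal.ofReal (F (u n) - F (u 0)) := by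
        rw [← ENNReal.ofReal_sum_of_nonneg, Finset.sum_range_sub (fun i => F (u i))]
        exact fun i _ => sub_nonneg.2 (hF _ _ (us i).1 (hle i) (us (i + 1)).2)
    _ ≤ ENNReal.ofReal (F q - F p) := by
        refine ENNReal.ofReal_le_ofReal ?_
        have h1 := hF (u n) q (us n).1 (us n).2 le_rfl
        have h2 := hF p (u 0) le_rfl (us 0).1 (us 0).2
        linarith

end Variation

/-! ### Quasihyperbolic geodesics are cone arcs -/

section ConeArcs

variable {X : Type*} [MetricSpace X] {δ A ε l : ℝ} {x x₀ : X} {α : ℝ → X}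

/-- Exponential growth of `d` along a quasihyperbolic geodesic makes it a cone arc: the length of
the part before `α t` is at most about `∫ d(α s) ds` over `s ≤ t`, a geometric integral. The
factor `2` bounds `(exp r - 1) / r` for `r ≤ 1`. -/
theorem IsQuasihyperbolicGeodesic.isConeArc (hX : ∀ z : X, 0 < boundaryDist z)
    (H : IsGromovHyperbolic δ (quasihyperbolicDist : X → X → ℝ≥0∞)) (hA : 0 < A) (hε : 0 < ε)
    (hα : IsQuasihyperbolicGeodesic α l x x₀)
    (hgrow : ∀ s t : ℝ, 0 ≤ s → s ≤ t → t ≤ l →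
      boundaryDist (α s) ≤ A * Real.exp (-(ε * (t - s))) * boundaryDist (α t)) {M : ℝ}
    (hM : 2 * A / ε ≤ M) : IsConeArc M α 0 l x x₀ := by
  have hloc : ∀ s t, 0 ≤ s → s ≤ t → t ≤ l → t - s ≤ 1 →
      dist (α s) (α t) ≤ boundaryDist (α s) * (2 * (t - s)) := by
    intro s t hs hst ht h1
    have h2 := H.dist_le_mul_exp_sub_one (hX (α s)) (α t)
    rw [hα.dist_eq s ⟨hs, hst.trans ht⟩ t ⟨hs.trans hst, ht⟩,
      ENNReal.toReal_ofReal (abs_nonneg _), abs_sub_comm, abs_of_nonneg (sub_nonneg.2 hst)] at h2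
    have h3 := Real.abs_exp_sub_one_le (x := t - s) (by rwa [abs_of_nonneg (sub_nonneg.2 hst)])
    rw [abs_of_nonneg (sub_nonneg.2 hst)] at h3
    have h4 := (le_abs_self _).trans h3
    have := hX (α s)
    refine h2.trans ?_
    gcongr
  have hdist : ∀ r ∈ Icc 0 l, ∀ s t, 0 ≤ s → s ≤ t → t ≤ r → dist (α s) (α t) ≤
      2 * A / ε * boundaryDist (α r) * Real.exp (-(ε * (r - t))) -
        2 * A / ε * boundaryDist (α r) * Real.exp (-(ε * (r - s))) := by
    intro r hr s t hs hst ht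
    refine dist_le_sub_of_locally_dist_le_sub (p := 0) (q := r) (f := α)
      (F := fun t => 2 * A / ε * boundaryDist (α r) * Real.exp (-(ε * (r - t))))
      (fun s t hs hst ht h1 => ?_) hs hst ht
    have hd := hX (α r)
    have h2 : ε * (t - s) ≤ Real.exp (ε * (t - s)) - 1 := by
      linarith [Real.add_one_le_exp (ε * (t - s))]
    have h3 : Real.exp (-(ε * (r - t))) =
        Real.exp (-(ε * (r - s))) * Real.exp (ε * (t - s)) := by
      rw [← Real.exp_add]; congr 1; ring
    calc dist (α s) (α t) ≤ boundaryDist (α s) * (2 * (t - s)) :=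
          hloc s t hs hst (ht.trans hr.2) h1
      _ ≤ A * Real.exp (-(ε * (r - s))) * boundaryDist (α r) * (2 * (t - s)) := by
          have := sub_nonneg.2 hst
          gcongr
          exact hgrow s r hs (hst.trans ht) hr.2
      _ = 2 * A / ε * boundaryDist (α r) * Real.exp (-(ε * (r - s))) * (ε * (t - s)) := by
          field_simp
      _ ≤ 2 * A / ε * boundaryDist (α r) * Real.exp (-(ε * (r - s))) *
            (Real.exp (ε * (t - s)) - 1) := by gcongr
      _ = _ := by rw [h3]; ring
  refine ⟨⟨hα.nonneg, hα.left, hα.right, ?_⟩, ?_, ?_⟩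
  · intro s hs
    have hbound : ∀ t ∈ Icc 0 l, dist (α t) (α s) ≤
        |2 * A / ε * boundaryDist (α l) * Real.exp (-(ε * (l - t))) -
          2 * A / ε * boundaryDist (α l) * Real.exp (-(ε * (l - s)))| := by
      intro t ht
      rcases le_total s t with h | h
      · rw [dist_comm]
        exact (hdist l (right_mem_Icc.2 hα.nonneg) s t hs.1 h ht.2).trans (le_abs_self _)
      · rw [abs_sub_comm]
        exact (hdist l (right_mem_Icc.2 hα.nonneg) t s ht.1 h hs.2).trans (le_abs_self _)
    refine tendsto_iff_dist_tendsto_zero.2 (squeeze_zero' (Filter.Eventually.of_forall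
      fun _ => dist_nonneg) (eventually_mem_nhdsWithin.mono hbound) ?_)
    refine Filter.Tendsto.mono_left ?_ nhdsWithin_le_nhds
    have hc : Continuous fun t => |2 * A / ε * boundaryDist (α l) * Real.exp (-(ε * (l - t))) -
        2 * A / ε * boundaryDist (α l) * Real.exp (-(ε * (l - s)))| := by fun_prop
    simpa using hc.tendsto s
  · intro s hs t ht hst
    have h := hα.dist_eq s hs t ht
    rw [hst, quasihyperbolicDist_self, eq_comm, ENNReal.ofReal_eq_zero] at h
    exact sub_eq_zero.1 (abs_nonpos_iff.1 h)
  · intro t ht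
    refine (eVariationOn_Icc_le_of_dist_le_sub
      (F := fun s => 2 * A / ε * boundaryDist (α t) * Real.exp (-(ε * (t - s))))
      (hdist t ht)).trans (ENNReal.ofReal_le_ofReal ?_)
    have hd := hX (α t)
    have h1 : 0 ≤ 2 * A / ε * boundaryDist (α t) * Real.exp (-(ε * (t - 0))) := by positivity
    have h2 : 2 * A / ε * boundaryDist (α t) ≤ M * boundaryDist (α t) := by gcongr
    rw [sub_self, mul_zero, neg_zero, Real.exp_zero, mul_one]
    linarith

end ConeArcs

/-- A quasihyperbolic geodesic starting from `x₀` and ending at `x` is a cone arc when, traversed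
from `x` to `x₀`, it is one. The constant `M` depends only on `a` and `δ`. -/
theorem theorem1p3 (a δ : ℝ) (ha : 1 ≤ a) (hδ : 0 ≤ δ) :
    ∃ M : ℝ, 1 ≤ M ∧
      ∀ (X : Type*) [MetricSpace X] [LocallyCompactSpace X],
        (metricBoundary X).Nonempty → RectifiablyConnected X →
        ∀ x₀ : X, IsJohnWithCenter a x₀ →
          IsGromovHyperbolic δ (quasihyperbolicDist : X → X → ℝ≥0∞) →
          (∀ (x : X) (α : ℝ → X) (l : ℝ), IsQuasihyperbolicGeodesic α l x₀ x →
            IsConeArc M (fun t => α (l - t)) 0 l x x₀) ∧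
          IsQuasihyperbolicJohn M x₀ := by
  obtain ⟨A, ε, hA, hε, hgrow⟩ := exists_boundaryDist_le_exp_neg_mul a δ ha hδ
  refine ⟨max 1 (2 * A / ε), le_max_left _ _, ?_⟩
  intro X _ _ hne _ x₀ hJ H
  have hX : ∀ z : X, 0 < boundaryDist z := boundaryDist_pos hne
  have hjohn : IsQuasihyperbolicJohn (max 1 (2 * A / ε)) x₀ := fun x α l hα =>
    hα.isConeArc hX H hA hε (hgrow X hX x₀ hJ H x α l hα) (le_max_right _ _)
  exact ⟨fun x α l hα => hjohn x _ l (IsGeodesicArc.reverse hα), hjohn⟩
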